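/- A graph may have loops and parallel edges; a loop is a cycle of length $1$ and two parallel edges form a cycle of length $2$. Let $f(n)$ be the maximum number of edges in a graph on $n$ vertices in which no two cycles have the same length. For nonnegative integers $a_1,\dots,a_n$ let $f(a_1,\dots,a_n)$ be the maximum number of edges in a graph on $n$ vertices that has at most $a_i$ cycles of length $i$ for every $1\le i\le n$. For an integer $m\ge 1$ let $g(n,m)=f(a_1,\dots,a_n)$, where $a_i=1$ if $m$ divides $i$ and $a_i=0$ otherwise. Then $$\liminf_{n\to\infty}\frac{f(n)-n}{\sqrt n}\ \ge\ \sqrt{2+\frac{40}{99}},$$ and, for every integer $m\ge 1$, $$\liminf_{n\to\infty}\frac{g(n,m)-n}{\sqrt{n/m}}\ \ge\ \sqrt{2+\frac{40}{99}}.$$ The same inequalities hold if, in the definitions of $f(n)$ and $g(n,m)$, only simple graphs are allowed. -/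

import Mathlib

open Filter

/-!
Finite graphs in which the numbers of cycles of each length are prescribed.

A *graph* is a `Graph` of Mathlib, in which loops and parallel edges are allowed; `Graph.Simple`
singles out the simple ones.  A cycle is identified with its set of edges.  A loop is a cycle of
length `1`, and two parallel edges form a cycle of length `2`.
-/

namespace CycleLengths

/-- `C` is the edge set of a cycle of length `k ≥ 1` of `G`: there are `k` distinct vertices
`v 0, …, v (k - 1)` and `k` distinct edges `e 0, …, e (k - 1)`, indexed cyclically, such that `e i`
joins `v i` to `v (i + 1)`, and `C` is the set of the edges `e i`. -/
def IsCycleOfLength {α β : Type*} (G : Graph α β) (k : ℕ) (C : Set β) : Prop :=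
  1 ≤ k ∧ ∃ (v : ZMod k → α) (e : ZMod k → β),
    Function.Injective v ∧ Function.Injective e ∧
      (∀ i, G.IsLink (e i) (v i) (v (i + 1))) ∧ C = Set.range e

/-- The number of cycles of length `k` of `G`. -/
noncomputable def cycleCount {α β : Type*} (G : Graph α β) (k : ℕ) : ℕ∞ :=
  {C : Set β | IsCycleOfLength G k C}.encard

/-- No two (different) cycles of `G` have the same length. -/
def DistinctCycleLengths {α β : Type*} (G : Graph α β) : Prop :=
  ∀ (k : ℕ) (C D : Set β), IsCycleOfLength G k C → IsCycleOfLength G k D → C = D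

/-- The possible numbers of edges of a graph on `n` vertices with property `P`. -/
def edgeNumbers (n : ℕ) (P : Graph (Fin n) ℕ → Prop) : Set ℕ :=
  {N | ∃ G : Graph (Fin n) ℕ, G.vertexSet = Set.univ ∧ G.edgeSet.encard = (N : ℕ∞) ∧ P G}

/-- `G` has at most `a i` cycles of length `i`, for `1 ≤ i ≤ n`. -/
def CycleCountsLE {n : ℕ} (a : ℕ → ℕ) (G : Graph (Fin n) ℕ) : Prop :=
  ∀ i, 1 ≤ i → i ≤ n → cycleCount G i ≤ (a i : ℕ∞)

/-- The sequence `a i = 1` if `m` divides `i`, and `a i = 0` otherwise. -/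
def multiplesOf (m : ℕ) (i : ℕ) : ℕ := if m ∣ i then 1 else 0

/-- `f n`: the maximum number of edges in a graph on `n` vertices in which no two cycles have the
same length. -/
noncomputable def f (n : ℕ) : ℕ :=
  sSup (edgeNumbers n fun G => DistinctCycleLengths G)

/-- `fSeq n a`, that is `f(a₁, …, aₙ)`: the maximum number of edges in a graph on `n` vertices
with at most `a i` cycles of length `i`, for `1 ≤ i ≤ n`. -/
noncomputable def fSeq (n : ℕ) (a : ℕ → ℕ) : ℕ :=
  sSup (edgeNumbers n fun G => CycleCountsLE a G)

/-- `g n m`: the value of `f(a₁, …, aₙ)` for `aᵢ = 1` if `m` divides `i` and `aᵢ = 0` otherwise. -/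
noncomputable def g (n m : ℕ) : ℕ := fSeq n (multiplesOf m)

/-- The analogue of `f` for simple graphs. -/
noncomputable def fSimple (n : ℕ) : ℕ :=
  sSup (edgeNumbers n fun G => G.Simple ∧ DistinctCycleLengths G)

/-- The analogue of `fSeq` for simple graphs. -/
noncomputable def fSeqSimple (n : ℕ) (a : ℕ → ℕ) : ℕ :=
  sSup (edgeNumbers n fun G => G.Simple ∧ CycleCountsLE a G)

/-- The analogue of `g` for simple graphs. -/
noncomputable def gSimple (n m : ℕ) : ℕ := fSeqSimple n (multiplesOf m)

/-! The suprema above are attained maxima. -/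

lemma isCycleOfLength_one {α β : Type*} {G : Graph α β} {x : α} {e : β} (h : G.IsLink e x x) :
    IsCycleOfLength G 1 {e} := by
  refine ⟨le_rfl, fun _ => x, fun _ => e, ?_, ?_, fun _ => h, ?_⟩
  · intro a b _; exact Subsingleton.elim (α := Fin 1) a b
  · intro a b _; exact Subsingleton.elim (α := Fin 1) a b
  · simp

lemma isCycleOfLength_two {α β : Type*} {G : Graph α β} {x y : α} {e e' : β} (hxy : x ≠ y)
    (hne : e ≠ e') (h : G.IsLink e x y) (h' : G.IsLink e' x y) :
    IsCycleOfLength G 2 {e, e'} := by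
  refine ⟨by norm_num, (![x, y] : Fin 2 → α), (![e, e'] : Fin 2 → β), ?_, ?_, ?_, ?_⟩
  · intro a b
    change Fin 2 at a b
    fin_cases a <;> fin_cases b <;> first | (intro; rfl) | simp [hxy, hxy.symm]
  · intro a b
    change Fin 2 at a b
    fin_cases a <;> fin_cases b <;> first | (intro; rfl) | simp [hne, hne.symm]
  · intro i
    change Fin 2 at i
    fin_cases i
    · exact h
    · exact h'.symm
  · exact (Matrix.range_cons_cons_empty e e' ![]).symm

lemma encard_link_le {n : ℕ} {a : ℕ → ℕ} {G : Graph (Fin n) ℕ} (hG : CycleCountsLE a G)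
    (x y : Fin n) : {e | G.IsLink e x y}.encard ≤ ((a 1 + a 2 + 1 : ℕ) : ℕ∞) := by
  by_cases hxy : x = y
  · subst hxy
    have h1 : {e | G.IsLink e x x}.encard ≤ cycleCount G 1 :=
      Set.encard_le_encard_of_injOn (f := fun e => ({e} : Set ℕ))
        (fun e he => isCycleOfLength_one he) (fun e _ e' _ h => Set.singleton_injective h)
    refine (h1.trans (hG 1 le_rfl (by have := x.2; omega))).trans ?_
    exact_mod_cast (by omega : a 1 ≤ a 1 + a 2 + 1)
  · have hn : 2 ≤ n := by
      have := x.2; have := y.2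
      have : (x : ℕ) ≠ y := fun h => hxy (Fin.ext h)
      omega
    rcases Set.eq_empty_or_nonempty {e | G.IsLink e x y} with h0 | ⟨e₀, he₀⟩
    · simp [h0]
    have h2 : ({e | G.IsLink e x y} \ {e₀}).encard ≤ cycleCount G 2 := by
      refine Set.encard_le_encard_of_injOn (f := fun e => ({e₀, e} : Set ℕ)) ?_ ?_
      · intro e he
        exact isCycleOfLength_two hxy (fun h => he.2 h.symm) he₀ he.1
      · intro e he e' he' h
        have h3 : e ∈ ({e₀, e'} : Set ℕ) := by
          rw [← show ({e₀, e} : Set ℕ) = {e₀, e'} from h]; simp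
        rcases h3 with h3 | h3
        · exact absurd h3 he.2
        · exact h3
    rw [← Set.encard_sdiff_singleton_add_one (show e₀ ∈ {e | G.IsLink e x y} from he₀)]
    refine (add_le_add_left (h2.trans (hG 2 (by norm_num) hn)) 1).trans ?_
    exact_mod_cast (by omega : a 2 + 1 ≤ a 1 + a 2 + 1)

lemma bddAbove_cycleCountsLE (n : ℕ) (a : ℕ → ℕ) :
    BddAbove (edgeNumbers n fun G => CycleCountsLE a G) := by
  refine ⟨∑ _p : Fin n × Fin n, (a 1 + a 2 + 1), ?_⟩
  rintro N ⟨G, -, hN, hG⟩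
  have hsub : G.edgeSet ⊆ ⋃ p : Fin n × Fin n, {e | G.IsLink e p.1 p.2} := by
    intro e he
    obtain ⟨x, y, h⟩ := Graph.exists_isLink_of_mem_edgeSet he
    exact Set.mem_iUnion.2 ⟨(x, y), h⟩
  have hfin : ∀ p : Fin n × Fin n, {e | G.IsLink e p.1 p.2}.Finite := fun p =>
    Set.finite_of_encard_le_coe (encard_link_le hG p.1 p.2)
  have h1 : G.edgeSet.ncard ≤ (⋃ p : Fin n × Fin n, {e | G.IsLink e p.1 p.2}).ncard :=
    Set.ncard_le_ncard hsub (Set.finite_iUnion hfin)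
  have h2 : N = G.edgeSet.ncard := by rw [Set.ncard, hN]; rfl
  rw [h2]
  refine (h1.trans (Set.ncard_iUnion_le_of_fintype _)).trans (Finset.sum_le_sum fun p _ => ?_)
  have := encard_link_le hG p.1 p.2
  rw [← (hfin p).cast_ncard_eq] at this
  exact_mod_cast this

lemma DistinctCycleLengths.cycleCountsLE {n : ℕ} {G : Graph (Fin n) ℕ}
    (h : DistinctCycleLengths G) : CycleCountsLE (fun _ => 1) G := fun i _ _ => by
  simpa [cycleCount, Set.encard_le_one_iff] using fun C D hC hD => h i C D hC hD

lemma not_isCycleOfLength_noEdge {n k : ℕ} {C : Set ℕ} :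
    ¬ IsCycleOfLength (Graph.noEdge (Set.univ : Set (Fin n)) ℕ) k C := by
  rintro ⟨-, v, e, -, -, h, -⟩
  simpa using h 0

lemma zero_mem_edgeNumbers {n : ℕ} {P : Graph (Fin n) ℕ → Prop}
    (h : P (Graph.noEdge Set.univ ℕ)) : 0 ∈ edgeNumbers n P :=
  ⟨Graph.noEdge Set.univ ℕ, by simp, by simp, h⟩

lemma isGreatest_sSup_edgeNumbers {n : ℕ} {P : Graph (Fin n) ℕ → Prop} (a : ℕ → ℕ)
    (hP : ∀ G, P G → CycleCountsLE a G) (h0 : P (Graph.noEdge Set.univ ℕ)) :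
    IsGreatest (edgeNumbers n P) (sSup (edgeNumbers n P)) := by
  have hb : BddAbove (edgeNumbers n P) := by
    refine (bddAbove_cycleCountsLE n a).mono ?_
    rintro N ⟨G, hV, hE, hG⟩
    exact ⟨G, hV, hE, hP G hG⟩
  exact ⟨Nat.sSup_mem ⟨0, zero_mem_edgeNumbers h0⟩ hb, fun N hN => le_csSup hb hN⟩

lemma cycleCountsLE_noEdge (n : ℕ) (a : ℕ → ℕ) :
    CycleCountsLE a (Graph.noEdge (Set.univ : Set (Fin n)) ℕ) := fun i _ _ => by
  simp [cycleCount, not_isCycleOfLength_noEdge]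

lemma distinctCycleLengths_noEdge (n : ℕ) :
    DistinctCycleLengths (Graph.noEdge (Set.univ : Set (Fin n)) ℕ) := fun _ _ _ hC _ =>
  absurd hC not_isCycleOfLength_noEdge

lemma isGreatest_f (n : ℕ) :
    IsGreatest (edgeNumbers n fun G => DistinctCycleLengths G) (f n) :=
  isGreatest_sSup_edgeNumbers (fun _ => 1) (fun _ h => h.cycleCountsLE)
    (distinctCycleLengths_noEdge n)

lemma isGreatest_fSeq (n : ℕ) (a : ℕ → ℕ) :
    IsGreatest (edgeNumbers n fun G => CycleCountsLE a G) (fSeq n a) :=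
  isGreatest_sSup_edgeNumbers a (fun _ h => h) (cycleCountsLE_noEdge n a)

lemma isGreatest_fSimple (n : ℕ) :
    IsGreatest (edgeNumbers n fun G => G.Simple ∧ DistinctCycleLengths G) (fSimple n) :=
  isGreatest_sSup_edgeNumbers (fun _ => 1) (fun _ h => h.2.cycleCountsLE)
    ⟨inferInstance, distinctCycleLengths_noEdge n⟩

lemma isGreatest_fSeqSimple (n : ℕ) (a : ℕ → ℕ) :
    IsGreatest (edgeNumbers n fun G => G.Simple ∧ CycleCountsLE a G) (fSeqSimple n a) :=
  isGreatest_sSup_edgeNumbers a (fun _ h => h.2) ⟨inferInstance, cycleCountsLE_noEdge n a⟩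

end CycleLengths

/-!
The lower bounds come from an explicit family of graphs, unions of *fans* that share one vertex, the
hub.  A fan is a path, its spine, joined to the hub by several paths, its legs.

Without the hub the union is a forest, so a cycle passes the hub exactly once, and it consists of two
legs of one fan and of the part of the spine between their ends
(`FanSystem.exists_eq_cycleEdges`, proved by counting the crossings of cuts modulo `2`).  A fan with
`k` legs therefore has `k (k - 1) / 2` cycles, and it raises the number of edges minus the number of
vertices by `k - 1`.  Subdividing every edge makes all cycle lengths multiples of `m`, and a pendant
path adjusts the number of vertices (`FanSystem.mem_edgeNumbers_of_le`).  Loops and parallel edges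
would be short cycles, so the graphs are simple.

It remains to choose fans with different cycle lengths that are economical
(`FanSystem.fans`, `FanSystem.len_fans_inj`).  With a parameter `r` and up to lower order terms, the
lengths below `168 r` are used by single cycles, those between `168 r` and `252 r` by theta graphs,
which have three legs, and the lengths from `252 r` on by `3 r` fans with `28` legs.
In such a fan all legs have the same length, between `84 r` and `126 r`, and their ends on the spine
are about `84 r` apart, so that the cycles formed by legs at distance `d` use an interval of lengths
of their own, from `168 r + 84 r d` to `252 r + 84 r d`.  For the cycles in this interval to have
different lengths, the ends are displaced by the discrete logarithm modulo `29`: its differences at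
distance `d` are different modulo `28` (`exists_log`), and the leg lengths of successive fans differ
by `14`.

The excess of edges over vertices is `305 r - O(1)` and the number of vertices is
`38556 m r ^ 2 + O(m r)`.  As `305 ^ 2 / 38556 = 2.4127…` exceeds `2 + 40 / 99 = 2.4040…`, the bounds
follow (`le_liminf_of_scale`).
-/

namespace CycleLengths

/-! ### Parity of cuts along a cycle -/

/-- A cycle crosses every cut an even number of times: for a `ZMod 2`-valued labelling `φ` of the
vertices, the changes of `φ` along the edges of a cycle add up to `0`. -/
lemma sum_cut_eq_zero {α β : Type*} [DecidableEq β] {G : Graph α β} {s t : β → α}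
    (hst : ∀ e x y, G.IsLink e x y → (x = s e ∧ y = t e) ∨ (x = t e ∧ y = s e))
    {k : ℕ} [NeZero k] {v : ZMod k → α} {e : ZMod k → β} (he : Function.Injective e)
    (hl : ∀ i, G.IsLink (e i) (v i) (v (i + 1))) (φ : α → ZMod 2) :
    ∑ x ∈ Finset.univ.image e, (φ (s x) + φ (t x)) = 0 := by
  rw [Finset.sum_image (fun a _ b _ h => he h)]
  have h1 : ∀ i, φ (s (e i)) + φ (t (e i)) = φ (v i) + φ (v (i + 1)) := by
    intro i
    rcases hst _ _ _ (hl i) with ⟨h, h'⟩ | ⟨h, h'⟩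
    · rw [h, h']
    · rw [h, h', add_comm]
  rw [Finset.sum_congr rfl fun i _ => h1 i, Finset.sum_add_distrib]
  have h2 : ∑ i, φ (v (i + 1)) = ∑ i, φ (v i) :=
    Equiv.sum_comp (Equiv.addRight (1 : ZMod k)) fun i => φ (v i)
  rw [h2]
  exact CharTwo.add_self_eq_zero _

/-! ### Fans sharing a hub -/

/-- A system of *fans* indexed by `B`.  The fan `b` consists of a path, its *spine*, with vertices
`0, …, Y b`, and of `k b` *legs*: the leg `j < k b` is a path with `a b j` edges from a hub, which
all fans have in common, to the vertex `y b j` of the spine. -/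
structure FanSystem (B : Type) where
  k : B → ℕ
  a : B → ℕ → ℕ
  y : B → ℕ → ℕ
  Y : B → ℕ
  one_le_a : ∀ b j, 1 ≤ a b j
  y_le_Y : ∀ b j, j < k b → y b j ≤ Y b
  y_mono : ∀ b i j, i ≤ j → j < k b → y b i ≤ y b j

/-- The edges: `inl ⟨b, j, q⟩` is the edge of the leg `j` of the fan `b` at distance `q` from the
hub, and `inr ⟨b, q⟩` is the edge of the spine of `b` from its vertex `q` to its vertex `q + 1`. -/
abbrev FanEdge (B : Type) : Type := (Σ _ : B, Σ _ : ℕ, ℕ) ⊕ (Σ _ : B, ℕ)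

/-- The vertices: `none` is the hub, `inl ⟨b, j, q⟩` is the vertex in the interior of the leg `j`
of the fan `b` at distance `q` from the hub, and `inr ⟨b, q⟩` is the vertex `q` of the spine. -/
abbrev FanVertex (B : Type) : Type := Option ((Σ _ : B, Σ _ : ℕ, ℕ) ⊕ (Σ _ : B, ℕ))

namespace FanSystem

variable {B : Type} (F : FanSystem B)

/-- The vertex of the leg `j` of the fan `b` at distance `q` from the hub. -/
def legVertex (b : B) (j q : ℕ) : FanVertex B :=
  if q = 0 then none else if q < F.a b j then some (.inl ⟨b, j, q⟩)
    else some (.inr ⟨b, F.y b j⟩)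

/-- The end of an edge nearer to the hub, or to the vertex `0` of the spine. -/
def src : FanEdge B → FanVertex B
  | .inl ⟨b, j, q⟩ => F.legVertex b j q
  | .inr ⟨b, q⟩ => some (.inr ⟨b, q⟩)

/-- The end of an edge farther from the hub, or from the vertex `0` of the spine. -/
def tgt : FanEdge B → FanVertex B
  | .inl ⟨b, j, q⟩ => F.legVertex b j (q + 1)
  | .inr ⟨b, q⟩ => some (.inr ⟨b, q + 1⟩)

/-- The length of the cycle formed by the legs `i < j` of the fan `b`. -/
def len (b : B) (i j : ℕ) : ℕ := F.a b i + F.a b j + (F.y b j - F.y b i)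

variable [Fintype B]

/-- The set of edges of the union of the fans. -/
def edges : Finset (FanEdge B) :=
  (Finset.univ.sigma fun b => (Finset.range (F.k b)).sigma fun j => Finset.range (F.a b j)).disjSum
    (Finset.univ.sigma fun b => Finset.range (F.Y b))

/-- The set of vertices of the union of the fans. -/
def vertices : Finset (FanVertex B) :=
  Finset.insertNone
    ((Finset.univ.sigma fun b =>
        (Finset.range (F.k b)).sigma fun j => Finset.Ico 1 (F.a b j)).disjSum
      (Finset.univ.sigma fun b => Finset.range (F.Y b + 1)))

lemma inl_mem_edges {b : B} {j q : ℕ} :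
    (.inl ⟨b, j, q⟩ : FanEdge B) ∈ F.edges ↔ j < F.k b ∧ q < F.a b j := by
  simp [edges]

lemma inr_mem_edges {b : B} {q : ℕ} : (.inr ⟨b, q⟩ : FanEdge B) ∈ F.edges ↔ q < F.Y b := by
  simp [edges]

lemma legVertex_mem {b : B} {j : ℕ} (q : ℕ) (hj : j < F.k b) : F.legVertex b j q ∈ F.vertices := by
  have := F.y_le_Y b j hj
  unfold legVertex
  split_ifs <;> simp [vertices] <;> omega

lemma src_mem {e : FanEdge B} (he : e ∈ F.edges) : F.src e ∈ F.vertices := by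
  rcases e with ⟨b, j, q⟩ | ⟨b, q⟩
  · exact F.legVertex_mem q (F.inl_mem_edges.1 he).1
  · have := F.inr_mem_edges.1 he
    simp [src, vertices]; omega

lemma tgt_mem {e : FanEdge B} (he : e ∈ F.edges) : F.tgt e ∈ F.vertices := by
  rcases e with ⟨b, j, q⟩ | ⟨b, q⟩
  · exact F.legVertex_mem (q + 1) (F.inl_mem_edges.1 he).1
  · have := F.inr_mem_edges.1 he
    simp [tgt, vertices]; omega

/-- The union of the fans, glued at the hub. -/
def graph : Graph (FanVertex B) (FanEdge B) where
  vertexSet := F.vertices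
  edgeSet := F.edges
  IsLink e x y := e ∈ F.edges ∧ ((x = F.src e ∧ y = F.tgt e) ∨ (x = F.tgt e ∧ y = F.src e))
  isLink_symm e _ := ⟨fun x y h => ⟨h.1, by tauto⟩⟩
  eq_or_eq_of_isLink_of_isLink := by
    rintro e x y v w ⟨_, h⟩ ⟨_, h'⟩
    rcases h with ⟨rfl, rfl⟩ | ⟨rfl, rfl⟩ <;> rcases h' with ⟨rfl, rfl⟩ | ⟨rfl, rfl⟩ <;> simp
  edge_mem_iff_exists_isLink e := by
    constructor
    · exact fun h => ⟨_, _, h, .inl ⟨rfl, rfl⟩⟩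
    · rintro ⟨_, _, h, _⟩; exact h
  left_mem_of_isLink := by
    rintro e x y ⟨he, ⟨rfl, -⟩ | ⟨rfl, -⟩⟩
    · exact F.src_mem he
    · exact F.tgt_mem he

lemma card_edges : F.edges.card = ∑ b, (∑ j ∈ Finset.range (F.k b), F.a b j + F.Y b) := by
  simp [edges, Finset.card_disjSum, Finset.card_sigma, Finset.sum_add_distrib]

/-- The Euler characteristic of the union of the fans. -/
lemma card_vertices_add : F.vertices.card + ∑ b, F.k b = F.edges.card + Fintype.card B + 1 := by
  have h : ∀ b, ∑ j ∈ Finset.range (F.k b), F.a b j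
      = ∑ j ∈ Finset.range (F.k b), (F.a b j - 1) + F.k b := by
    intro b
    rw [Finset.sum_congr rfl fun j _ => (Nat.sub_add_cancel (F.one_le_a b j)).symm,
      Finset.sum_add_distrib]
    simp
  simp only [card_edges, h]
  simp [vertices, Finset.card_disjSum, Finset.card_sigma, Finset.sum_add_distrib]
  omega

end FanSystem

namespace FanSystem

variable {B : Type} (F : FanSystem B)

/-! ### The cycles of a union of fans -/

lemma src_eq_inl {b : B} {j q : ℕ} (hq : q + 1 < F.a b j) (x : FanEdge B) :
    F.src x = some (.inl ⟨b, j, q + 1⟩) ↔ x = .inl ⟨b, j, q + 1⟩ := by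
  rcases x with ⟨b', j', q'⟩ | ⟨b', q'⟩ <;> grind [src, legVertex]

lemma tgt_eq_inl {b : B} {j q : ℕ} (hq : q + 1 < F.a b j) (x : FanEdge B) :
    F.tgt x = some (.inl ⟨b, j, q + 1⟩) ↔ x = .inl ⟨b, j, q⟩ := by
  rcases x with ⟨b', j', q'⟩ | ⟨b', q'⟩ <;> grind [tgt, legVertex]

open Classical in
/-- The indicator of the part `{q, q + 1, …}` of the spine of the fan `b`. -/
noncomputable def spineCut (b : B) (q : ℕ) : FanVertex B → ZMod 2
  | some (.inr ⟨b', q'⟩) => if b' = b ∧ q ≤ q' then 1 else 0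
  | _ => 0

open Classical in
/-- The edges that leave the part `{q, q + 1, …}` of the spine of the fan `b`: the edge of the spine
between `q - 1` and `q`, and the last edges of the legs that end in this part. -/
lemma spineCut_src_add_tgt [Fintype B] {x : FanEdge B} (hx : x ∈ F.edges) (b : B) (q : ℕ) :
    spineCut b q (F.src x) + spineCut b q (F.tgt x) =
      (if 0 < q ∧ x = .inr ⟨b, q - 1⟩ then 1 else 0) +
        ∑ j ∈ (Finset.range (F.k b)).filter fun j => q ≤ F.y b j,
          if x = .inl ⟨b, j, F.a b j - 1⟩ then 1 else 0 := by
  rcases x with ⟨b', j', q'⟩ | ⟨b', q'⟩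
  · obtain ⟨hj, hq⟩ := F.inl_mem_edges.1 hx
    have h1 : spineCut b q (F.src (.inl ⟨b', j', q'⟩)) = 0 := by
      by_cases h : q' = 0 <;> simp [src, legVertex, h, hq, spineCut]
    rw [h1, zero_add, if_neg (by simp), zero_add]
    by_cases hb : b' = b
    · subst hb
      by_cases hl : q' + 1 < F.a b' j'
      · rw [Finset.sum_eq_zero]
        · simp [tgt, legVertex, hl, spineCut]
        · intro j _
          rw [if_neg]
          grind
      · have hl' : F.a b' j' - 1 = q' := by omega
        have h2 : ∀ j, ((.inl ⟨b', j', q'⟩ : FanEdge B) = .inl ⟨b', j, F.a b' j - 1⟩) ↔ j = j' := by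
          intro j
          constructor
          · grind
          · rintro rfl; rw [hl']
        simp only [h2, Finset.sum_ite_eq']
        simp [tgt, legVertex, hl, spineCut, hj]
    · rw [Finset.sum_eq_zero]
      · simp only [tgt, legVertex]
        split_ifs <;> simp [spineCut, hb]
      · intro j _
        rw [if_neg]
        grind
  · rw [Finset.sum_eq_zero (fun j _ => if_neg (by simp)), add_zero]
    by_cases hb : b' = b
    · subst hb
      have h2 : (0 < q ∧ (.inr ⟨b', q'⟩ : FanEdge B) = .inr ⟨b', q - 1⟩) ↔ q' + 1 = q := by
        constructor
        · grind
        · rintro rfl; simp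
      simp only [src, tgt, spineCut, true_and, h2]
      rcases lt_trichotomy (q' + 1) q with h | h | h
      · rw [if_neg (by omega), if_neg (by omega), if_neg (by omega)]; rfl
      · rw [if_neg (by omega), if_pos (by omega), if_pos (by omega)]; rfl
      · rw [if_pos (by omega), if_pos (by omega), if_neg (by omega)]; rfl
    · rw [if_neg (by grind)]
      simp [src, tgt, spineCut, hb]

open Classical in
/-- The edge set of the cycle formed by the legs `i < j` of the fan `b`. -/
noncomputable def cycleEdges (b : B) (i j : ℕ) : Finset (FanEdge B) :=
  (({b} : Finset B).sigma fun b =>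
      ({i, j} : Finset ℕ).sigma fun j => Finset.range (F.a b j)).disjSum
    (({b} : Finset B).sigma fun b => Finset.Ico (F.y b i) (F.y b j))

lemma card_cycleEdges {b : B} {i j : ℕ} (hij : i < j) :
    (F.cycleEdges b i j).card = F.len b i j := by
  simp [cycleEdges, Finset.card_disjSum, Finset.card_sigma, Finset.sum_pair hij.ne, len]

lemma inl_mem_cycleEdges {b b' : B} {i j j' q : ℕ} :
    (.inl ⟨b', j', q⟩ : FanEdge B) ∈ F.cycleEdges b i j ↔
      b' = b ∧ (j' = i ∨ j' = j) ∧ q < F.a b' j' := by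
  simp [cycleEdges]

lemma inr_mem_cycleEdges {b b' : B} {i j q : ℕ} :
    (.inr ⟨b', q⟩ : FanEdge B) ∈ F.cycleEdges b i j ↔
      b' = b ∧ F.y b' i ≤ q ∧ q < F.y b' j := by
  simp [cycleEdges]

open Classical in
/-- Every cycle of the union of the fans consists of two legs of one fan and of the part of the
spine between their ends.  The cycle cuts every vertex in the interior of a leg evenly, so it
contains a leg entirely or not at all; it passes the hub at most once, so it contains at most two
legs; and it cuts every final part of a spine evenly, so the legs in it determine its other edges. -/
theorem exists_eq_cycleEdges [Fintype B] {n : ℕ} {C : Set (FanEdge B)}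
    (hC : IsCycleOfLength F.graph n C) :
    ∃ b i j, i < j ∧ j < F.k b ∧ C = F.cycleEdges b i j ∧ n = F.len b i j := by
  obtain ⟨hn, v, e, hv, he, hl, rfl⟩ := hC
  have : NeZero n := ⟨by omega⟩
  set S : Finset (FanEdge B) := Finset.univ.image e with hS
  have hcard : S.card = n := by
    rw [hS, Finset.card_image_of_injective _ he, Finset.card_univ, ZMod.card]
  have hrange : Set.range e = S := by simp [hS]
  have hsub : ∀ x ∈ S, x ∈ F.edges := by
    intro x hx
    obtain ⟨i, -, rfl⟩ := Finset.mem_image.1 hx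
    exact (hl i).1
  have hcut : ∀ φ : FanVertex B → ZMod 2, ∑ x ∈ S, (φ (F.src x) + φ (F.tgt x)) = 0 :=
    sum_cut_eq_zero (G := F.graph) (fun _ _ _ h => h.2) he hl
  -- cuts around a single vertex in the interior of a leg
  have hstep : ∀ b j q, q + 1 < F.a b j →
      ((.inl ⟨b, j, q + 1⟩ : FanEdge B) ∈ S ↔ (.inl ⟨b, j, q⟩ : FanEdge B) ∈ S) := by
    intro b j q hq
    have h := hcut fun x => if x = some (.inl ⟨b, j, q + 1⟩) then 1 else 0
    simp only [F.src_eq_inl hq, F.tgt_eq_inl hq, Finset.sum_add_distrib, Finset.sum_ite_eq'] at h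
    by_cases h1 : (.inl ⟨b, j, q + 1⟩ : FanEdge B) ∈ S <;>
      by_cases h2 : (.inl ⟨b, j, q⟩ : FanEdge B) ∈ S <;> simp [h1, h2] at h ⊢
  have hleg : ∀ b j q, q < F.a b j →
      ((.inl ⟨b, j, q⟩ : FanEdge B) ∈ S ↔ (.inl ⟨b, j, 0⟩ : FanEdge B) ∈ S) := by
    intro b j q
    induction q with
    | zero => simp
    | succ q ih => exact fun hq => (hstep b j q hq).trans (ih (by omega))
  -- cuts around a final part of a spine; for `q = 0` this is the whole spine
  have hspine : ∀ b q, (if 0 < q ∧ (.inr ⟨b, q - 1⟩ : FanEdge B) ∈ S then (1 : ZMod 2) else 0) +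
      (((Finset.range (F.k b)).filter fun j =>
        q ≤ F.y b j ∧ (.inl ⟨b, j, 0⟩ : FanEdge B) ∈ S).card : ZMod 2) = 0 := by
    intro b q
    have h := hcut (spineCut b q)
    rw [Finset.sum_congr rfl fun x hx => F.spineCut_src_add_tgt (hsub x hx) b q,
      Finset.sum_add_distrib, Finset.sum_comm] at h
    refine Eq.trans ?_ h
    congr 1
    · by_cases hq : 0 < q <;> simp [hq]
    · rw [← Finset.filter_filter, Finset.card_filter, Nat.cast_sum]
      refine Finset.sum_congr rfl fun j _ => ?_
      have := F.one_le_a b j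
      simp [← hleg b j (F.a b j - 1) (by omega)]
  -- among three first edges of legs two coincide, as only two edges of the cycle meet the hub
  have hhub : ∀ x y z : (Σ _ : B, ℕ), (.inl ⟨x.1, x.2, 0⟩ : FanEdge B) ∈ S →
      (.inl ⟨y.1, y.2, 0⟩ : FanEdge B) ∈ S → (.inl ⟨z.1, z.2, 0⟩ : FanEdge B) ∈ S →
      x = y ∨ x = z ∨ y = z := by
    have key : ∀ x : (Σ _ : B, ℕ), (.inl ⟨x.1, x.2, 0⟩ : FanEdge B) ∈ S →
        ∃ i, e i = .inl ⟨x.1, x.2, 0⟩ ∧ (v i = none ∨ v (i + 1) = none) := by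
      intro x hx
      obtain ⟨i, -, hi⟩ := Finset.mem_image.1 hx
      refine ⟨i, hi, ?_⟩
      have h0 : F.src (e i) = none := by rw [hi]; simp [src, legVertex]
      rcases (hl i).2 with h | h
      · left; rw [h.1, h0]
      · right; rw [h.2, h0]
    intro x y z hx hy hz
    obtain ⟨i, hi, hi'⟩ := key x hx
    obtain ⟨j, hj, hj'⟩ := key y hy
    obtain ⟨l, hl, hl'⟩ := key z hz
    have h : i = j ∨ i = l ∨ j = l := by
      have hvv : ∀ {p q}, v p = none → v q = none → p = q := fun h h' => hv (h.trans h'.symm)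
      rcases hi' with a | a <;> rcases hj' with b | b <;> rcases hl' with c | c
      all_goals
        first
        | exact .inl (hvv a b)
        | exact .inl (add_right_cancel (hvv a b))
        | exact .inr (.inl (hvv a c))
        | exact .inr (.inl (add_right_cancel (hvv a c)))
        | exact .inr (.inr (hvv b c))
        | exact .inr (.inr (add_right_cancel (hvv b c)))
    have hinj : ∀ {x y : (Σ _ : B, ℕ)},
        (.inl ⟨x.1, x.2, 0⟩ : FanEdge B) = .inl ⟨y.1, y.2, 0⟩ → x = y := by
      rintro ⟨x1, x2⟩ ⟨y1, y2⟩ h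
      grind
    rcases h with rfl | rfl | rfl
    · exact .inl (hinj (hi.symm.trans hj))
    · exact .inr (.inl (hinj (hi.symm.trans hl)))
    · exact .inr (.inr (hinj (hj.symm.trans hl)))
  -- some leg lies in the cycle
  have hex : ∃ b j, (.inl ⟨b, j, 0⟩ : FanEdge B) ∈ S := by
    have hne : e 0 ∈ S := Finset.mem_image_of_mem _ (Finset.mem_univ _)
    rcases h0 : e 0 with ⟨b, j, q⟩ | ⟨b, q⟩
    · rw [h0] at hne
      exact ⟨b, j, (hleg b j q (F.inl_mem_edges.1 (hsub _ hne)).2).1 hne⟩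
    · rw [h0] at hne
      have h := hspine b (q + 1)
      rw [if_pos (by simpa using hne)] at h
      by_contra! hcon
      simp [hcon] at h
  obtain ⟨b, j₁, hj₁⟩ := hex
  -- the number of legs of the fan `b` in the cycle is even, so there is a second one
  obtain ⟨j₂, hj₂, hne⟩ : ∃ j₂, (.inl ⟨b, j₂, 0⟩ : FanEdge B) ∈ S ∧ j₂ ≠ j₁ := by
    by_contra! hcon
    have h := hspine b 0
    have h1 : ((Finset.range (F.k b)).filter fun j =>
        0 ≤ F.y b j ∧ (.inl ⟨b, j, 0⟩ : FanEdge B) ∈ S) = {j₁} := by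
      ext j
      have := (F.inl_mem_edges.1 (hsub _ hj₁)).1
      simp only [Finset.mem_filter, Finset.mem_range, Finset.mem_singleton]
      constructor
      · exact fun h => hcon j h.2.2
      · rintro rfl; exact ⟨this, Nat.zero_le _, hj₁⟩
    rw [h1] at h
    simp at h
  obtain ⟨i, j, hij, hi, hj⟩ : ∃ i j, i < j ∧ (.inl ⟨b, i, 0⟩ : FanEdge B) ∈ S ∧
      (.inl ⟨b, j, 0⟩ : FanEdge B) ∈ S := by
    rcases lt_or_gt_of_ne hne with h | h
    · exact ⟨_, _, h, hj₂, hj₁⟩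
    · exact ⟨_, _, h, hj₁, hj₂⟩
  have hjk := (F.inl_mem_edges.1 (hsub _ hj)).1
  have honly : ∀ b' j', (.inl ⟨b', j', 0⟩ : FanEdge B) ∈ S ↔ b' = b ∧ (j' = i ∨ j' = j) := by
    intro b' j'
    constructor
    · intro h
      have := hhub ⟨b, i⟩ ⟨b, j⟩ ⟨b', j'⟩ hi hj h
      grind
    · rintro ⟨rfl, rfl | rfl⟩ <;> assumption
  have hSe : S = F.cycleEdges b i j := by
    ext x
    rcases x with ⟨b', j', q⟩ | ⟨b', q⟩
    · rw [inl_mem_cycleEdges]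
      constructor
      · intro h
        have hq := (F.inl_mem_edges.1 (hsub _ h)).2
        have := (honly b' j').1 ((hleg _ _ _ hq).1 h)
        exact ⟨this.1, this.2, hq⟩
      · rintro ⟨h1, h2, h3⟩
        exact (hleg _ _ _ h3).2 ((honly _ _).2 ⟨h1, h2⟩)
    · rw [inr_mem_cycleEdges]
      have h := hspine b' (q + 1)
      by_cases hb : b' = b
      · subst hb
        have hy := F.y_mono b' i j hij.le hjk
        have h1 : ((Finset.range (F.k b')).filter fun l =>
            q + 1 ≤ F.y b' l ∧ (.inl ⟨b', l, 0⟩ : FanEdge B) ∈ S)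
              = ({i, j} : Finset ℕ).filter fun l => q + 1 ≤ F.y b' l := by
          ext l
          simp only [honly, Finset.mem_filter, Finset.mem_range, Finset.mem_insert,
            Finset.mem_singleton]
          constructor
          · tauto
          · rintro ⟨h | h, h'⟩ <;> subst h <;> exact ⟨by omega, h', by simp⟩
        rw [h1, Finset.card_filter, Finset.sum_pair hij.ne] at h
        by_cases hm : (.inr ⟨b', q⟩ : FanEdge B) ∈ S <;> by_cases hqi : q + 1 ≤ F.y b' i <;>
          by_cases hqj : q + 1 ≤ F.y b' j <;> simp [hm, hqi, hqj] at h ⊢ <;> first | omega | skip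
        exact absurd h (by decide)
      · have h1 : ((Finset.range (F.k b')).filter fun l =>
            q + 1 ≤ F.y b' l ∧ (.inl ⟨b', l, 0⟩ : FanEdge B) ∈ S) = ∅ := by
          ext l
          simp [honly, hb]
        rw [h1] at h
        by_cases hm : (.inr ⟨b', q⟩ : FanEdge B) ∈ S
        · simp [hm] at h
        · simp [hm, hb]
  refine ⟨b, i, j, hij, hjk, by rw [hrange, hSe], ?_⟩
  rw [← hcard, hSe, F.card_cycleEdges hij]

end FanSystem
/-! ### Relabelling vertices and edges -/

/-- A graph with `n` vertices and countably many edge labels is isomorphic to a graph on `Fin n`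
with edge labels in `ℕ`. -/
lemma exists_relabel {α β : Type*} [Countable β] (G : Graph α β) {V : Finset α} {E : Finset β}
    (hV : G.vertexSet = V) (hE : G.edgeSet = E) {n : ℕ} (hn : V.card = n) :
    ∃ (G' : Graph (Fin n) ℕ) (τ : β → ℕ), G'.vertexSet = Set.univ ∧
      G'.edgeSet.encard = (E.card : ℕ∞) ∧
      ∀ k C, IsCycleOfLength G' k C → ∃ D, IsCycleOfLength G k D ∧ C = τ '' D := by
  obtain ⟨τ, hτ⟩ := exists_injective_nat β
  let σ : Fin n → α := fun x => ((V.equivFinOfCardEq hn).symm x : α)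
  have hσ : Function.Injective σ :=
    Subtype.val_injective.comp (V.equivFinOfCardEq hn).symm.injective
  have hσV : ∀ x ∈ V, ∃ i, σ i = x := fun x hx => ⟨V.equivFinOfCardEq hn ⟨x, hx⟩, by simp [σ]⟩
  have hmem : ∀ {e x y}, G.IsLink e x y → ∃ i j, σ i = x ∧ σ j = y := by
    intro e x y h
    have hx := h.left_mem
    have hy := h.right_mem
    rw [hV] at hx hy
    obtain ⟨i, hi⟩ := hσV x hx
    obtain ⟨j, hj⟩ := hσV y hy
    exact ⟨i, j, hi, hj⟩
  let G' : Graph (Fin n) ℕ :=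
    { vertexSet := Set.univ
      IsLink := fun e x y => ∃ e₀, τ e₀ = e ∧ G.IsLink e₀ (σ x) (σ y)
      edgeSet := τ '' E
      isLink_symm := fun e _ => ⟨fun x y ⟨e₀, h, h'⟩ => ⟨e₀, h, h'.symm⟩⟩
      eq_or_eq_of_isLink_of_isLink := by
        rintro e x y v w ⟨e₀, rfl, h⟩ ⟨e₁, h1, h'⟩
        obtain rfl := hτ h1
        exact (h.left_eq_or_eq h').imp (fun a => hσ a) fun a => hσ a
      edge_mem_iff_exists_isLink := by
        intro e
        constructor
        · rintro ⟨e₀, he, rfl⟩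
          rw [← hE] at he
          obtain ⟨x, y, h⟩ := Graph.exists_isLink_of_mem_edgeSet he
          obtain ⟨i, j, rfl, rfl⟩ := hmem h
          exact ⟨i, j, e₀, rfl, h⟩
        · rintro ⟨x, y, e₀, rfl, h⟩
          exact ⟨e₀, hE ▸ h.edge_mem, rfl⟩
      left_mem_of_isLink := fun _ _ _ _ => Set.mem_univ _ }
  refine ⟨G', τ, rfl, ?_, ?_⟩
  · change (τ '' (E : Set β)).encard = _
    rw [hτ.encard_image, Set.encard_coe_eq_coe_finsetCard]
  · rintro k C ⟨hk, v, e, hv, he, hl, rfl⟩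
    choose e₀ h₀ h₁ using hl
    have hee : e = τ ∘ e₀ := funext fun i => (h₀ i).symm
    refine ⟨Set.range e₀, ⟨hk, σ ∘ v, e₀, hσ.comp hv, ?_, h₁, rfl⟩, ?_⟩
    · rw [hee] at he
      exact he.of_comp
    · rw [hee, Set.range_comp]

/-- A graph all of whose cycles have length at least `3` is simple. -/
lemma simple_of_three_le {α β : Type*} {G : Graph α β}
    (h : ∀ k C, IsCycleOfLength G k C → 3 ≤ k) : G.Simple where
  not_isLoopAt e x hx := by
    have := h _ _ (isCycleOfLength_one hx)
    omega
  eq_of_isLink e e' x y he he' := by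
    by_contra hne
    by_cases hxy : x = y
    · subst hxy
      have := h _ _ (isCycleOfLength_one he)
      omega
    · have := h _ _ (isCycleOfLength_two hxy hne he he')
      omega

/-- If the cycles of a union of fans have distinct lengths, all at least `3` and divisible by `m`,
then the union satisfies all the conditions in the definitions of `f`, `g` and their analogues for
simple graphs. -/
theorem FanSystem.card_edges_mem_edgeNumbers {B : Type} [Fintype B] (F : FanSystem B) {m : ℕ}
    (hinj : ∀ b i j b' i' j', i < j → j < F.k b → i' < j' → j' < F.k b' →
      F.len b i j = F.len b' i' j' → b = b' ∧ i = i' ∧ j = j')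
    (hthree : ∀ b i j, i < j → j < F.k b → 3 ≤ F.len b i j)
    (hdvd : ∀ b i j, i < j → j < F.k b → m ∣ F.len b i j) :
    F.edges.card ∈ edgeNumbers F.vertices.card fun G =>
      G.Simple ∧ DistinctCycleLengths G ∧ CycleCountsLE (multiplesOf m) G := by
  obtain ⟨G, τ, hV, hE, hG⟩ := exists_relabel F.graph (V := F.vertices) (E := F.edges) rfl rfl rfl
  have hcyc : ∀ k C, IsCycleOfLength G k C →
      ∃ b i j, i < j ∧ j < F.k b ∧ C = τ '' F.cycleEdges b i j ∧ k = F.len b i j := by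
    intro k C hC
    obtain ⟨D, hD, rfl⟩ := hG k C hC
    obtain ⟨b, i, j, hij, hj, rfl, hk⟩ := F.exists_eq_cycleEdges hD
    exact ⟨b, i, j, hij, hj, rfl, hk⟩
  have hdist : DistinctCycleLengths G := by
    intro k C D hC hD
    obtain ⟨b, i, j, hij, hj, rfl, rfl⟩ := hcyc k C hC
    obtain ⟨b', i', j', hij', hj', rfl, hk⟩ := hcyc _ D hD
    obtain ⟨rfl, rfl, rfl⟩ := hinj _ _ _ _ _ _ hij hj hij' hj' hk
    rfl
  refine ⟨G, hV, hE, simple_of_three_le ?_, hdist, ?_⟩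
  · intro k C hC
    obtain ⟨b, i, j, hij, hj, -, rfl⟩ := hcyc k C hC
    exact hthree b i j hij hj
  · intro l h1 h2
    unfold multiplesOf
    split_ifs with h
    · exact hdist.cycleCountsLE l h1 h2
    · simp only [cycleCount, Nat.cast_zero, nonpos_iff_eq_zero, Set.encard_eq_zero,
        Set.eq_empty_iff_forall_notMem]
      intro C hC
      obtain ⟨b, i, j, hij, hj, -, rfl⟩ := hcyc l C hC
      exact h (hdvd b i j hij hj)

/-! ### Discrete logarithms and Costas arrays -/

/-- The discrete logarithm modulo a prime `p` is a Costas array: its differences at any two places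
at the same distance `d` are different modulo `p - 1`. -/
lemma exists_log (p : ℕ) [hp : Fact p.Prime] : ∃ l : ℕ → ℕ, (∀ u, l u < p - 1) ∧
    ∀ u v d, 0 < u → 0 < v → 0 < d → u + d < p → v + d < p →
      l (u + d) + l v ≡ l (v + d) + l u [MOD p - 1] → u = v := by
  have h1 : 1 < p := hp.out.one_lt
  have : NeZero (p - 1) := ⟨by omega⟩
  obtain ⟨g, hg⟩ := IsCyclic.exists_generator (α := (ZMod p)ˣ)
  have hcard : Nat.card (ZMod p)ˣ = p - 1 := by
    rw [Nat.card_eq_fintype_card, ZMod.card_units]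
  let θ : Multiplicative (ZMod (p - 1)) ≃* (ZMod p)ˣ := zmodMulEquivOfGenerator hg hcard
  classical
  let U : ℕ → (ZMod p)ˣ := fun u => if h : (u : ZMod p) ≠ 0 then Units.mk0 u h else 1
  have hU : ∀ u, 0 < u → u < p → ((U u : (ZMod p)ˣ) : ZMod p) = u := by
    intro u h0 hup
    have : (u : ZMod p) ≠ 0 := by
      rw [Ne, ZMod.natCast_eq_zero_iff]
      exact fun h => absurd (Nat.le_of_dvd h0 h) (by omega)
    simp [U, this]
  let l : ℕ → ℕ := fun u => (Multiplicative.toAdd (θ.symm (U u))).val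
  have hl : ∀ u, ((l u : ℕ) : ZMod (p - 1)) = Multiplicative.toAdd (θ.symm (U u)) := by
    intro u; simp [l]
  refine ⟨l, fun u => ZMod.val_lt _, ?_⟩
  intro u v d hu hv hd hud hvd h
  rw [← ZMod.natCast_eq_natCast_iff] at h
  push_cast at h
  simp only [hl, ← toAdd_mul, ← map_mul] at h
  have h2 : U (u + d) * U v = U (v + d) * U u :=
    θ.symm.injective (Multiplicative.toAdd.injective h)
  have h3 := congrArg (fun x : (ZMod p)ˣ => (x : ZMod p)) h2
  simp only [Units.val_mul] at h3
  rw [hU _ (by omega) hud, hU _ hv (by omega), hU _ (by omega) hvd, hU _ hu (by omega)] at h3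
  -- `(u + d) v = (v + d) u` means `d v = d u`
  push_cast at h3
  have hd0 : (d : ZMod p) ≠ 0 := by
    rw [Ne, ZMod.natCast_eq_zero_iff]
    exact fun h => absurd (Nat.le_of_dvd hd h) (by omega)
  have h4 : (d : ZMod p) * v = d * u := by linear_combination h3
  have h5 := mul_left_cancel₀ hd0 h4
  rw [ZMod.natCast_eq_natCast_iff', Nat.mod_eq_of_lt (by omega), Nat.mod_eq_of_lt (by omega)] at h5
  exact h5.symm

namespace FanSystem

/-! ### Subdividing edges and hanging a path from the hub -/

variable {B : Type} (F : FanSystem B)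

/-- Every edge is replaced by a path with `m` edges. -/
def scale (m : ℕ) (hm : 1 ≤ m) : FanSystem B where
  k := F.k
  a b j := m * F.a b j
  y b j := m * F.y b j
  Y b := m * F.Y b
  one_le_a b j := Nat.mul_pos hm (F.one_le_a b j)
  y_le_Y b j hj := Nat.mul_le_mul_left m (F.y_le_Y b j hj)
  y_mono b i j hij hj := Nat.mul_le_mul_left m (F.y_mono b i j hij hj)

/-- A path with `p` edges is hung from the hub, as a fan with a single leg. -/
def addPath (p : ℕ) (hp : 1 ≤ p) : FanSystem (Option B) where
  k b := b.elim 1 F.k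
  a b := b.elim (fun _ => p) F.a
  y b := b.elim (fun _ => 0) F.y
  Y b := b.elim 0 F.Y
  one_le_a b j := by
    cases b
    · exact hp
    · exact F.one_le_a _ j
  y_le_Y b j hj := by
    cases b
    · exact le_rfl
    · exact F.y_le_Y _ j hj
  y_mono b i j hij hj := by
    cases b
    · exact le_rfl
    · exact F.y_mono _ i j hij hj

lemma len_scale (m : ℕ) (hm : 1 ≤ m) (b : B) (i j : ℕ) :
    (F.scale m hm).len b i j = m * F.len b i j := by
  simp only [len, scale, ← Nat.mul_sub, mul_add]

/-- A union of fans with distinct cycle lengths yields graphs on all sufficiently large numbers of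
vertices: the edges are subdivided so that `m` divides the cycle lengths, and a pendant path supplies
the remaining vertices. -/
theorem mem_edgeNumbers_of_le [Fintype B] {m n : ℕ} (hm : 1 ≤ m)
    (hinj : ∀ b i j b' i' j', i < j → j < F.k b → i' < j' → j' < F.k b' →
      F.len b i j = F.len b' i' j' → b = b' ∧ i = i' ∧ j = j')
    (hthree : ∀ b i j, i < j → j < F.k b → 3 ≤ F.len b i j)
    (hn : m * F.edges.card + Fintype.card B + 2 ≤ n + ∑ b, F.k b) :
    n + ∑ b, F.k b - (Fintype.card B + 1) ∈ edgeNumbers n fun G =>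
      G.Simple ∧ DistinctCycleLengths G ∧ CycleCountsLE (multiplesOf m) G := by
  obtain ⟨p, hp⟩ := Nat.exists_eq_add_of_le hn
  let H := (F.scale m hm).addPath (p + 1) (by omega)
  have hE : H.edges.card = m * F.edges.card + (p + 1) := by
    rw [card_edges, card_edges, Fintype.sum_option, Finset.mul_sum, add_comm]
    congr 1
    refine Finset.sum_congr rfl fun b _ => ?_
    rw [mul_add, Finset.mul_sum]
    rfl
  have hk : ∑ b, H.k b = ∑ b, F.k b + 1 := by
    rw [Fintype.sum_option, add_comm]
    rfl
  have hV := H.card_vertices_add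
  rw [hE, hk, Fintype.card_option] at hV
  have hn' : H.vertices.card = n := by omega
  have hE' : H.edges.card = n + ∑ b, F.k b - (Fintype.card B + 1) := by omega
  have hlen : ∀ b i j, H.len (some b) i j = m * F.len b i j := fun b i j => F.len_scale m hm b i j
  rw [← hE', ← hn']
  refine H.card_edges_mem_edgeNumbers ?_ ?_ ?_
  · intro b i j b' i' j' hij hj hij' hj' h
    cases b with
    | none => exact absurd hj (by simp only [H, addPath, Option.elim]; omega)
    | some b =>
      cases b' with
      | none => exact absurd hj' (by simp only [H, addPath, Option.elim]; omega)
      | some b' =>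
        rw [hlen, hlen] at h
        obtain ⟨rfl, hij⟩ := hinj b i j b' i' j' hij hj hij' hj' (Nat.eq_of_mul_eq_mul_left hm h)
        exact ⟨rfl, hij⟩
  · intro b i j hij hj
    cases b with
    | none => exact absurd hj (by simp only [H, addPath, Option.elim]; omega)
    | some b =>
      rw [hlen]
      exact (hthree b i j hij hj).trans (Nat.le_mul_of_pos_left _ hm)
  · intro b i j hij hj
    cases b with
    | none => exact absurd hj (by simp only [H, addPath, Option.elim]; omega)
    | some b => rw [hlen]; exact dvd_mul_right _ _

/-! ### A system of fans with distinct cycle lengths -/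

/-- Corrections of the lengths of the three legs in the four kinds of theta graphs.  The sums of
two of the three numbers in each row are `0, 0, 0`, then `2, 1, 1`, then `1, 2, 3`, then `3, 3, 2`:
each of the three sums takes every value `0, 1, 2, 3` once. -/
def thetaShift (c : Fin 4) (j : ℕ) : ℕ :=
  (![![0, 0, 0], ![1, 1, 0], ![0, 1, 2], ![2, 1, 1]] c : Fin 3 → ℕ) (Fin.ofNat 3 j)

/-- For the scale `r`, three kinds of fans: single cycles, with all lengths in `[4, 168 r)`; theta
graphs, whose cycles have all lengths in `[168 r, 252 r)`; and `3 r` fans with `28` legs of equal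
length, whose ends on the spine are equally spaced up to a correction by the function `l`. -/
def fans (r : ℕ) (hr : 1 ≤ r) (l : ℕ → ℕ) (hl : ∀ u, l u < 28) :
    FanSystem (Fin (168 * r - 4) ⊕ (Fin (7 * r) × Fin 4) ⊕ Fin (3 * r)) where
  k := Sum.elim (fun _ => 2) (Sum.elim (fun _ => 3) fun _ => 28)
  a := Sum.elim (fun s j => 2 + j * s) (Sum.elim
    (fun t j => 70 * r + 28 * r * j + 2 * t.1 + thetaShift t.2 j)
    fun i _ => 84 * r - 14 + 14 * i)
  y := Sum.elim (fun _ _ => 0) (Sum.elim (fun _ _ => 0)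
    fun _ v => (84 * r + 56) * v + l (v + 1))
  Y := Sum.elim (fun _ => 0) (Sum.elim (fun _ => 0) fun _ => (84 * r + 56) * 27 + 27)
  one_le_a b j := by
    rcases b with b | b | b <;> simp only [Sum.elim_inl, Sum.elim_inr] <;> omega
  y_le_Y b j hj := by
    rcases b with b | b | b <;> simp only [Sum.elim_inl, Sum.elim_inr] at hj ⊢
    · exact le_rfl
    · exact le_rfl
    · have := hl (j + 1)
      have := Nat.mul_le_mul_left (84 * r + 56) (show j ≤ 27 by omega)
      omega
  y_mono b i j hij hj := by
    rcases b with b | b | b <;> simp only [Sum.elim_inl, Sum.elim_inr]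
    · exact le_rfl
    · exact le_rfl
    · rcases hij.eq_or_lt with rfl | hij
      · exact le_rfl
      · have := hl (i + 1)
        have := Nat.mul_le_mul_left (84 * r + 56) (show i + 1 ≤ j by omega)
        rw [mul_add] at this
        omega

section

variable {r : ℕ} (hr : 1 ≤ r) {l : ℕ → ℕ} (hl : ∀ u, l u < 28)

lemma len_single (s : Fin (168 * r - 4)) {i j : ℕ} (hij : i < j) (hj : j < 2) :
    i = 0 ∧ j = 1 ∧ (fans r hr l hl).len (.inl s) i j = s + 4 := by
  obtain rfl : j = 1 := by omega
  obtain rfl : i = 0 := by omega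
  refine ⟨rfl, rfl, ?_⟩
  simp [len, fans]
  omega

lemma len_theta (t : Fin (7 * r) × Fin 4) {i j : ℕ} (hij : i < j) (hj : j < 3) :
    (fans r hr l hl).len (.inr (.inl t)) i j =
      140 * r + 28 * r * (i + j) + 4 * t.1 + (thetaShift t.2 i + thetaShift t.2 j) := by
  interval_cases j <;> interval_cases i <;> simp [len, fans] <;> ring

lemma len_fan (b : Fin (3 * r)) {i j : ℕ} (hij : i < j) :
    (fans r hr l hl).len (.inr (.inr b)) i j + l (i + 1) + 28 =
      168 * r + 28 * b + (84 * r + 56) * (j - i) + l (j + 1) := by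
  obtain ⟨d, rfl⟩ := Nat.exists_eq_add_of_le hij.le
  have := hl (i + 1)
  have := Nat.mul_le_mul_left (84 * r + 56) (show 1 ≤ d by omega)
  simp only [len, fans, Sum.elim_inr, Nat.add_sub_cancel_left, mul_add]
  omega

lemma thetaShift_add_lt (c : Fin 4) {i j : ℕ} (hij : i < j) (hj : j < 3) :
    thetaShift c i + thetaShift c j < 4 := by
  revert c
  interval_cases j <;> interval_cases i <;> decide

lemma thetaShift_add_inj {c c' : Fin 4} {i j : ℕ} (hij : i < j) (hj : j < 3)
    (h : thetaShift c i + thetaShift c j = thetaShift c' i + thetaShift c' j) : c = c' := by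
  revert c c'
  interval_cases j <;> interval_cases i <;> decide

lemma len_theta_mem (t : Fin (7 * r) × Fin 4) {i j : ℕ} (hij : i < j) (hj : j < 3) :
    168 * r ≤ (fans r hr l hl).len (.inr (.inl t)) i j ∧
      (fans r hr l hl).len (.inr (.inl t)) i j < 252 * r := by
  have := thetaShift_add_lt t.2 hij hj
  have := t.1.2
  rw [len_theta hr hl t hij hj]
  interval_cases j <;> interval_cases i <;> omega

lemma le_len_fan (b : Fin (3 * r)) {i j : ℕ} (hij : i < j) :
    252 * r ≤ (fans r hr l hl).len (.inr (.inr b)) i j := by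
  have := len_fan hr hl b hij
  have := hl (i + 1)
  have := Nat.mul_le_mul_left (84 * r + 56) (show 1 ≤ j - i by omega)
  omega

/-- The cycles of all `fans` have distinct lengths if `l` is the discrete logarithm modulo `29`.
In the fans with `28` legs, the length of a cycle first determines the distance `d` of its two
legs, then, modulo `28`, the legs, by the Costas property of `l`, and at last the fan. -/
theorem len_fans_inj
    (hlog : ∀ u v d, 0 < u → 0 < v → 0 < d → u + d < 29 → v + d < 29 →
      l (u + d) + l v ≡ l (v + d) + l u [MOD 28] → u = v)
    {b b' : Fin (168 * r - 4) ⊕ (Fin (7 * r) × Fin 4) ⊕ Fin (3 * r)} {i j i' j' : ℕ}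
    (hij : i < j) (hj : j < (fans r hr l hl).k b) (hij' : i' < j')
    (hj' : j' < (fans r hr l hl).k b')
    (h : (fans r hr l hl).len b i j = (fans r hr l hl).len b' i' j') :
    b = b' ∧ i = i' ∧ j = j' := by
  rcases b with s | t | b <;> rcases b' with s' | t' | b' <;>
    simp only [fans, Sum.elim_inl, Sum.elim_inr] at hj hj'
  · obtain ⟨rfl, rfl, h1⟩ := len_single hr hl s hij hj
    obtain ⟨rfl, rfl, h2⟩ := len_single hr hl s' hij' hj'
    refine ⟨congrArg _ (Fin.ext ?_), rfl, rfl⟩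
    omega
  · have := (len_single hr hl s hij hj).2.2
    have := len_theta_mem hr hl t' hij' hj'
    omega
  · have := (len_single hr hl s hij hj).2.2
    have := le_len_fan hr hl b' hij'
    omega
  · have := (len_single hr hl s' hij' hj').2.2
    have := len_theta_mem hr hl t hij hj
    omega
  · rw [len_theta hr hl t hij hj, len_theta hr hl t' hij' hj'] at h
    have h1 := thetaShift_add_lt t.2 hij hj
    have h2 := thetaShift_add_lt t'.2 hij' hj'
    have h3 := t.1.2
    have h4 := t'.1.2
    have hii : i = i' ∧ j = j' := by
      interval_cases j <;> interval_cases i <;> interval_cases j' <;> interval_cases i' <;> omega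
    obtain ⟨rfl, rfl⟩ := hii
    refine ⟨congrArg _ (congrArg _ (Prod.ext (Fin.ext ?_) (thetaShift_add_inj hij hj ?_))), rfl, rfl⟩
    all_goals omega
  · have := len_theta_mem hr hl t hij hj
    have := le_len_fan hr hl b' hij'
    omega
  · have := (len_single hr hl s' hij' hj').2.2
    have := le_len_fan hr hl b hij
    omega
  · have := len_theta_mem hr hl t' hij' hj'
    have := le_len_fan hr hl b hij
    omega
  · have e1 := len_fan hr hl b hij
    have e2 := len_fan hr hl b' hij'
    obtain ⟨d, rfl⟩ := Nat.exists_eq_add_of_le hij.le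
    obtain ⟨d', rfl⟩ := Nat.exists_eq_add_of_le hij'.le
    rw [Nat.add_sub_cancel_left] at e1 e2
    have h1 := hl (i + 1)
    have h2 := hl (i' + 1)
    have h3 := hl (i + d + 1)
    have h4 := hl (i' + d' + 1)
    have h5 := b.2
    have h6 := b'.2
    have hdd : d = d' := by
      rcases lt_trichotomy d d' with hd | hd | hd
      · have := Nat.mul_le_mul_left (84 * r + 56) (show d + 1 ≤ d' from hd)
        rw [mul_add (84 * r + 56) d 1] at this
        omega
      · exact hd
      · have := Nat.mul_le_mul_left (84 * r + 56) (show d' + 1 ≤ d from hd)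
        rw [mul_add (84 * r + 56) d' 1] at this
        omega
    subst hdd
    have hmod : l (i + 1 + d) + l (i' + 1) ≡ l (i' + 1 + d) + l (i + 1) [MOD 28] := by
      rw [add_right_comm i, add_right_comm i']
      unfold Nat.ModEq
      omega
    have := hlog (i + 1) (i' + 1) d (by omega) (by omega) (by omega) (by omega) (by omega) hmod
    obtain rfl : i = i' := by omega
    refine ⟨congrArg _ (congrArg _ (Fin.ext ?_)), rfl, rfl⟩
    omega

lemma three_le_len_fans {b : Fin (168 * r - 4) ⊕ (Fin (7 * r) × Fin 4) ⊕ Fin (3 * r)} {i j : ℕ}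
    (hij : i < j) (hj : j < (fans r hr l hl).k b) : 3 ≤ (fans r hr l hl).len b i j := by
  rcases b with s | t | b <;> simp only [fans, Sum.elim_inl, Sum.elim_inr] at hj
  · have := (len_single hr hl s hij hj).2.2
    omega
  · have := (len_theta_mem hr hl t hij hj).1
    omega
  · have := le_len_fan hr hl b hij
    omega

lemma two_mul_sum_fin_le (n : ℕ) : 2 * ∑ i : Fin n, (i : ℕ) ≤ n * n := by
  rw [Fin.sum_univ_eq_sum_range (fun i => i), mul_comm, Finset.sum_range_id_mul_two]
  exact Nat.mul_le_mul_left n (Nat.sub_le n 1)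

lemma card_edges_fans_le : (fans r hr l hl).edges.card ≤ 38556 * r ^ 2 + 5000 * r := by
  rw [card_edges, Fintype.sum_sum_type, Fintype.sum_sum_type, Fintype.sum_prod_type]
  have h1 : ∑ s : Fin (168 * r - 4), (∑ j ∈ Finset.range ((fans r hr l hl).k (.inl s)),
      (fans r hr l hl).a (.inl s) j + (fans r hr l hl).Y (.inl s)) ≤ 14112 * r ^ 2 := by
    have h2 : ∀ s : Fin (168 * r - 4), ∑ j ∈ Finset.range ((fans r hr l hl).k (.inl s)),
        (fans r hr l hl).a (.inl s) j + (fans r hr l hl).Y (.inl s) = 4 + s := by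
      intro s
      simp [fans, Finset.sum_range_succ]
      omega
    rw [Finset.sum_congr rfl fun s _ => h2 s, Finset.sum_add_distrib]
    have h3 := two_mul_sum_fin_le (168 * r - 4)
    obtain ⟨q, hq⟩ : ∃ q, 168 * r = q + 4 := ⟨168 * r - 4, by omega⟩
    have h4 : 168 * r - 4 = q := by omega
    rw [h4] at h3 ⊢
    simp only [Finset.sum_const, Finset.card_univ, Fintype.card_fin, smul_eq_mul]
    have h5 : 28224 * r ^ 2 = (q + 4) ^ 2 := by rw [← hq]; ring
    nlinarith
  have h2 : ∑ t : Fin (7 * r), ∑ c : Fin 4,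
      (∑ j ∈ Finset.range ((fans r hr l hl).k (.inr (.inl (t, c)))),
      (fans r hr l hl).a (.inr (.inl (t, c))) j + (fans r hr l hl).Y (.inr (.inl (t, c)))) ≤
      8820 * r ^ 2 + 63 * r := by
    have h3 : ∀ t : Fin (7 * r), ∑ c : Fin 4,
        (∑ j ∈ Finset.range ((fans r hr l hl).k (.inr (.inl (t, c)))),
        (fans r hr l hl).a (.inr (.inl (t, c))) j + (fans r hr l hl).Y (.inr (.inl (t, c)))) =
        1176 * r + 9 + 24 * t := by
      intro t
      have hs : ∑ c : Fin 4, (thetaShift c 0 + thetaShift c 1 + thetaShift c 2) = 9 := by decide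
      rw [Fin.sum_univ_four] at hs
      simp [fans, Finset.sum_range_succ, Fin.sum_univ_four]
      omega
    rw [Finset.sum_congr rfl fun t _ => h3 t, Finset.sum_add_distrib, ← Finset.mul_sum]
    have h4 := two_mul_sum_fin_le (7 * r)
    simp only [Finset.sum_const, Finset.card_univ, Fintype.card_fin, smul_eq_mul]
    nlinarith
  have h3 : ∑ b : Fin (3 * r), (∑ j ∈ Finset.range ((fans r hr l hl).k (.inr (.inr b))),
      (fans r hr l hl).a (.inr (.inr b)) j + (fans r hr l hl).Y (.inr (.inr b))) ≤
      15624 * r ^ 2 + 4617 * r := by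
    have h4 : ∀ b : Fin (3 * r), (∑ j ∈ Finset.range ((fans r hr l hl).k (.inr (.inr b))),
        (fans r hr l hl).a (.inr (.inr b)) j + (fans r hr l hl).Y (.inr (.inr b))) ≤
        4620 * r + 1539 + 392 * b := by
      intro b
      simp only [fans, Sum.elim_inr, Finset.sum_const, Finset.card_range, smul_eq_mul]
      omega
    refine (Finset.sum_le_sum fun b _ => h4 b).trans ?_
    rw [Finset.sum_add_distrib, ← Finset.mul_sum]
    have h5 := two_mul_sum_fin_le (3 * r)
    simp only [Finset.sum_const, Finset.card_univ, Fintype.card_fin, smul_eq_mul]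
    nlinarith
  have := Nat.add_le_add h1 (Nat.add_le_add h2 h3)
  refine this.trans ?_
  nlinarith

lemma sum_k_fans : ∑ b, (fans r hr l hl).k b + 4 =
    Fintype.card (Fin (168 * r - 4) ⊕ (Fin (7 * r) × Fin 4) ⊕ Fin (3 * r)) + 305 * r := by
  rw [Fintype.sum_sum_type, Fintype.sum_sum_type]
  simp [fans]
  omega

end

end FanSystem

/-- The graphs that prove the lower bounds: about `38556 m r ^ 2` vertices suffice for an excess of
`305 r - 5` edges. -/
theorem mem_edgeNumbers_of_scale_le {m n r : ℕ} (hm : 1 ≤ m) (hr : 1 ≤ r)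
    (hn : m * (38556 * r ^ 2 + 5000 * r) ≤ n) :
    n + (305 * r - 5) ∈ edgeNumbers n fun G =>
      G.Simple ∧ DistinctCycleLengths G ∧ CycleCountsLE (multiplesOf m) G := by
  have : Fact (Nat.Prime 29) := ⟨by norm_num⟩
  obtain ⟨l, hl, hlog⟩ := exists_log 29
  have hE := Nat.mul_le_mul_left m (FanSystem.card_edges_fans_le hr hl)
  have hk := FanSystem.sum_k_fans hr hl
  have := (FanSystem.fans r hr l hl).mem_edgeNumbers_of_le (m := m) (n := n) hm
    (fun _ _ _ _ _ _ => FanSystem.len_fans_inj hr hl hlog)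
    (fun _ _ _ => FanSystem.three_le_len_fans hr hl) (by omega)
  convert this using 1
  omega

/-! ### The lower limits -/

/-- For a given `n`, the scale is `r = ⌊√(n / (38600 m))⌋`; the bound holds because
`305 ^ 2 / 38600 > 2 + 40 / 99`. -/
lemma le_liminf_of_scale {N : ℕ → ℕ} {m : ℕ} (hm : 1 ≤ m)
    (hN : ∀ n r, 1 ≤ r → m * (38556 * r ^ 2 + 5000 * r) ≤ n → n + (305 * r - 5) ≤ N n) :
    ((√(2 + 40 / 99) : ℝ) : EReal) ≤
      liminf (fun n : ℕ => ((((N n : ℝ) - n) / √((n : ℝ) / (m : ℝ)) : ℝ) : EReal)) atTop := by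
  have hm0 : (0 : ℝ) < m := by exact_mod_cast hm
  refine le_liminf_of_le (by isBoundedDefault) ?_
  have hlim : Tendsto (fun n : ℕ => √((n : ℝ) / m / 38600)) atTop atTop :=
    Real.tendsto_sqrt_atTop.comp
      ((tendsto_natCast_atTop_atTop.atTop_div_const hm0).atTop_div_const (by norm_num))
  filter_upwards [hlim.eventually_ge_atTop 1100] with n hn
  rw [EReal.coe_le_coe_iff]
  set x : ℝ := (n : ℝ) / m with hx
  set u : ℝ := √(x / 38600) with hu
  have hx0 : 0 ≤ x := by positivity
  have hxu : x = 38600 * u ^ 2 := by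
    rw [hu, Real.sq_sqrt (by positivity)]
    ring
  -- `38600` in place of `38556` absorbs the term `5000 * r`, as `r` is large
  set r : ℕ := ⌊u⌋₊ with hr
  have hru : (r : ℝ) ≤ u := Nat.floor_le (by linarith)
  have hur : u < r + 1 := Nat.lt_floor_add_one u
  have hr1 : (1099 : ℝ) < r := by linarith
  have hr1' : 1099 < r := by exact_mod_cast hr1
  have hle : m * (38556 * r ^ 2 + 5000 * r) ≤ n := by
    have h1 : (38556 * r ^ 2 + 5000 * r : ℝ) ≤ x := by
      rw [hxu]
      nlinarith
    have h2 : (m : ℝ) * (38556 * r ^ 2 + 5000 * r) ≤ n := by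
      calc (m : ℝ) * (38556 * r ^ 2 + 5000 * r) ≤ m * x := by gcongr
        _ = n := by rw [hx]; field_simp
    exact_mod_cast h2
  have hNn := hN n r (by omega) hle
  have hNr : (n : ℝ) + 305 * r ≤ N n + 5 := by
    have : n + 305 * r ≤ N n + 5 := by omega
    exact_mod_cast this
  have hxpos : 0 < x := by rw [hxu]; nlinarith
  rw [le_div_iff₀ (Real.sqrt_pos.2 hxpos), ← Real.sqrt_mul (by norm_num)]
  -- `(2 + 40 / 99) * 38600 < 304.7 ^ 2`, and `304.7 * u ≤ 305 * (u - 1) - 5` as `1100 ≤ u`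
  have hsqrt : √((2 + 40 / 99) * x) ≤ 304.7 * u := by
    rw [Real.sqrt_le_left (by linarith), hxu]
    nlinarith [sq_nonneg u]
  linarith

end CycleLengths

theorem mainTheorem3 :
    (((√(2 + 40 / 99) : ℝ) : EReal) ≤
        liminf (fun n : ℕ => ((((CycleLengths.f n : ℝ) - n) / √(n : ℝ) : ℝ) : EReal)) atTop ∧
      ∀ m : ℕ, 1 ≤ m →
        ((√(2 + 40 / 99) : ℝ) : EReal) ≤
          liminf (fun n : ℕ =>
            ((((CycleLengths.g n m : ℝ) - n) / √((n : ℝ) / (m : ℝ)) : ℝ) : EReal)) atTop) ∧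
    (((√(2 + 40 / 99) : ℝ) : EReal) ≤
        liminf (fun n : ℕ => ((((CycleLengths.fSimple n : ℝ) - n) / √(n : ℝ) : ℝ) : EReal)) atTop ∧
      ∀ m : ℕ, 1 ≤ m →
        ((√(2 + 40 / 99) : ℝ) : EReal) ≤
          liminf (fun n : ℕ =>
            ((((CycleLengths.gSimple n m : ℝ) - n) / √((n : ℝ) / (m : ℝ)) : ℝ) : EReal)) atTop) := by
  open CycleLengths in
  refine ⟨⟨?_, fun m hm => ?_⟩, ?_, fun m hm => ?_⟩
  · have h := le_liminf_of_scale (N := f) le_rfl fun n r hr hn => by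
      obtain ⟨G, hV, hE, -, hG, -⟩ := mem_edgeNumbers_of_scale_le le_rfl hr hn
      exact (isGreatest_f n).2 ⟨G, hV, hE, hG⟩
    simpa only [Nat.cast_one, div_one] using h
  · refine le_liminf_of_scale (N := fun n => g n m) hm fun n r hr hn => ?_
    obtain ⟨G, hV, hE, -, -, hG⟩ := mem_edgeNumbers_of_scale_le hm hr hn
    exact (isGreatest_fSeq n _).2 ⟨G, hV, hE, hG⟩
  · have h := le_liminf_of_scale (N := fSimple) le_rfl fun n r hr hn => by
      obtain ⟨G, hV, hE, hS, hG, -⟩ := mem_edgeNumbers_of_scale_le le_rfl hr hn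
      exact (isGreatest_fSimple n).2 ⟨G, hV, hE, hS, hG⟩
    simpa only [Nat.cast_one, div_one] using h
  · refine le_liminf_of_scale (N := fun n => gSimple n m) hm fun n r hr hn => ?_
    obtain ⟨G, hV, hE, hS, -, hG⟩ := mem_edgeNumbers_of_scale_le hm hr hn
    exact (isGreatest_fSeqSimple n _).2 ⟨G, hV, hE, hS, hG⟩
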